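/- All graphs are finite and simple. For disjoint vertex sets $X,Y$ of a graph $G$, $\operatorname{cutrank}_G(X,Y)$ is the rank over $\mathbb F_2$ of the $X\times Y$ biadjacency matrix. Let $\operatorname{min-bal-cutrank}(G)$ be the minimum of $\operatorname{cutrank}_G(X,Y)$ over all partitions $(X,Y)$ of $V(G)$ with $|X|,|Y|\le \tfrac23|V(G)|$; for a one-vertex graph, which has no such partition, the value is $0$. A rank-decomposition of $G$ is a tree $T$ of maximum degree at most $3$ together with a bijection from $V(G)$ to the leaves of $T$ (a one-node tree has one leaf); deleting an edge $e$ of $T$ induces a partition $(X_e,Y_e)$ of $V(G)$, the width of the decomposition is $\max_{e\in E(T)}\operatorname{cutrank}_G(X_e,Y_e)$ ($0$ if $T$ has no edge), and $\operatorname{rankwidth}(G)$ is the minimum width of a rank-decomposition of $G$ ($0$ if $G$ has no vertices). **Theorem.** Let $G$ be a finite simple graph. For every real $r\ge 1$, if $\operatorname{rankwidth}(G)\ge 72r$, then $G$ has an induced subgraph $H$ with $\operatorname{min-bal-cutrank}(H)\ge r$. Moreover $$\tfrac1{72}\operatorname{rankwidth}(G)\;\le\;\max_{H}\operatorname{min-bal-cutrank}(H)\;\le\;\operatorname{rankwidth}(G),$$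 where the maximum is over all induced subgraphs $H$ of $G$. -/

import Mathlib

open scoped Classical in
/-- The rank over the two-element field of the biadjacency matrix of `G` with rows `X` and
columns `Y`. -/
noncomputable def cutrank {V : Type*} (G : SimpleGraph V) (X Y : Finset V) : ℕ :=
  Matrix.rank (Matrix.of fun (x : {x // x ∈ X}) (y : {y // y ∈ Y}) =>
    if G.Adj x.1 y.1 then (1 : ZMod 2) else 0)

/-- `(X, Y)` is a partition of the vertex set into two parts, each containing at most two thirds
of all vertices. -/
def IsBalancedPartition {V : Type*} [Fintype V] (X Y : Finset V) : Prop :=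
  Disjoint X Y ∧ (∀ v, v ∈ X ∨ v ∈ Y) ∧
    3 * X.card ≤ 2 * Fintype.card V ∧ 3 * Y.card ≤ 2 * Fintype.card V

/-- The minimum cutrank of a balanced partition. A balanced partition exists unless the graph has
exactly one vertex, in which case the value is `0` (the infimum of the empty set in `ℕ`). -/
noncomputable def minBalCutrank {V : Type*} [Fintype V] (G : SimpleGraph V) : ℕ :=
  sInf {c | ∃ X Y : Finset V, IsBalancedPartition X Y ∧ c = cutrank G X Y}

open scoped Classical in
/-- A rank-decomposition of a graph with vertex set `V`: a finite tree of maximum degree at most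
three, with a bijection from `V` to its leaves. The tree with a single node has one leaf. -/
structure RankDecomposition (V : Type*) where
  size : ℕ
  tree : SimpleGraph (Fin size)
  isTree : tree.IsTree
  degree_le : ∀ t, tree.degree t ≤ 3
  leaf : V ≃ {t : Fin size // tree.degree t ≤ 1}

namespace RankDecomposition

open scoped Classical in
/-- The vertices whose leaf lies in the same component as `a` after deleting the edge `ab` from
the tree. -/
noncomputable def side {V : Type*} [Fintype V] (D : RankDecomposition V) (a b : Fin D.size) :
    Finset V :=
  {v | (D.tree.deleteEdges {s(a, b)}).Reachable a (D.leaf v).1}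

open scoped Classical in
/-- The maximum over all tree edges of the cutrank of the induced partition (each edge is listed
in both orientations). It is `0` for the tree without edges. -/
noncomputable def width {V : Type*} [Fintype V] (G : SimpleGraph V) (D : RankDecomposition V) :
    ℕ :=
  Finset.univ.sup fun d : D.tree.Dart => cutrank G (D.side d.fst d.snd) (D.side d.snd d.fst)

end RankDecomposition

/-- The minimum width of a rank-decomposition. The graph without vertices has no
rank-decomposition, and its rankwidth is `0` (the infimum of the empty family in `ℕ`). -/
noncomputable def rankwidth {V : Type*} [Fintype V] (G : SimpleGraph V) : ℕ :=
  ⨅ D : RankDecomposition V, D.width G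

/-- The maximum of the minimum balanced cutrank over all induced subgraphs. -/
noncomputable def maxInducedMinBalCutrank {V : Type*} [Fintype V] (G : SimpleGraph V) : ℕ :=
  (Finset.univ : Finset (Finset V)).sup fun S => minBalCutrank (G.induce (S : Set V))

/-! Write λ for `connectivity`, the cutrank of a set against its complement. For max min-bal-cutrank
≤ rankwidth, some edge of any decomposition tree splits a given set S of at least two vertices into
parts of size at most 2|S|/3 (`exists_balanced_edge`), and restricting its partition to S cannot
raise the cutrank.

For the converse, let k ≥ 1 and suppose every induced subgraph on at least two vertices has a
balanced cut of rank at most k. If the vertex set cannot be assembled from singletons within width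
48k + 1, there is a tangle, a consistent choice of small sides for the sets with λ ≤ 16k
(`exists_isTangle`); complements of small sets with λ ≤ 16k are big. For each c, let B be a big set
minimizing |B| + cλ(B). If λ(B) ≤ 15k, a balanced cut of B has a big part, and minimality gives |B|
≤ 3ck. If λ(B) ≥ 15k, then cλ(B) < 4|B|: otherwise add to B a set Y of cλ(B) outside vertices whose
subsets are all well linked to the rest (`exists_evenly_linked_subset`). A balanced cut of Y ∪ B has
much of Y on each side, which forces both traces on B to have smaller λ, although one of them is
big. These bounds let no minimizer drop below 15k as c grows from 0, but for huge c the whole vertex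
set, with λ = 0, beats every set with λ ≥ 15k. So an assembly exists, and it yields a tree of width
48k + 1 ≤ 72k. If k = 0, the graph has no edges. -/

/-! ### Linear algebra of cutrank. -/

/-- The row of the adjacency matrix of `G` over the two-element field at `x`. -/
noncomputable def adjRow {V : Type*} (G : SimpleGraph V) (x : V) : V → ZMod 2 :=
  open scoped Classical in fun y => if G.Adj x y then 1 else 0

/-- The span of the adjacency rows of the vertices in `X`. -/
noncomputable def rowSpan {V : Type*} (G : SimpleGraph V) (X : Finset V) :
    Submodule (ZMod 2) (V → ZMod 2) :=
  Submodule.span (ZMod 2) (adjRow G '' (X : Set V))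

/-- The vectors vanishing on `A`. -/
def vanishingOn {V : Type*} (A : Finset V) : Submodule (ZMod 2) (V → ZMod 2) :=
  LinearMap.ker (LinearMap.funLeft (ZMod 2) (ZMod 2) (Subtype.val : {y // y ∈ A} → V))

theorem mem_vanishingOn {V : Type*} {A : Finset V} {f : V → ZMod 2} :
    f ∈ vanishingOn A ↔ ∀ y ∈ A, f y = 0 := by
  simp [vanishingOn, LinearMap.mem_ker, funext_iff, LinearMap.funLeft_apply]

theorem vanishingOn_union {V : Type*} [DecidableEq V] (A B : Finset V) :
    vanishingOn (A ∪ B) = vanishingOn A ⊓ vanishingOn B := by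
  ext f
  simp only [Submodule.mem_inf, mem_vanishingOn, Finset.mem_union]
  grind

theorem vanishingOn_inter {V : Type*} [DecidableEq V] (A B : Finset V) :
    vanishingOn (A ∩ B) = vanishingOn A ⊔ vanishingOn B := by
  ext f
  simp only [Submodule.mem_sup, mem_vanishingOn, Finset.mem_inter]
  constructor
  · intro h
    refine ⟨fun y => if y ∈ A then 0 else f y, by grind, fun y => if y ∈ A then f y else 0,
      by grind, ?_⟩
    ext y
    by_cases hy : y ∈ A <;> simp [hy]
  · rintro ⟨g, hg, h, hh, rfl⟩ y ⟨hA, hB⟩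
    simp [hg y hA, hh y hB]

theorem rowSpan_union {V : Type*} [DecidableEq V] (G : SimpleGraph V) (X Y : Finset V) :
    rowSpan G (X ∪ Y) = rowSpan G X ⊔ rowSpan G Y := by
  simp [rowSpan, Set.image_union, Submodule.span_union]

theorem rowSpan_mono {V : Type*} (G : SimpleGraph V) {X Y : Finset V} (h : X ⊆ Y) :
    rowSpan G X ≤ rowSpan G Y :=
  Submodule.span_mono (Set.image_mono (by exact_mod_cast h))

/-- Restriction to the coordinates in `A` has kernel `vanishingOn A` and maps the row span onto the
row space of the submatrix. Bisubmodularity thus reduces to the dimension formula for sums and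
intersections. -/
theorem cutrank_add_finrank_vanishingOn {V : Type*} [Fintype V] (G : SimpleGraph V)
    (X A : Finset V) :
    cutrank G X A + Module.finrank (ZMod 2) (vanishingOn A) =
      Module.finrank (ZMod 2) ↥(rowSpan G X ⊔ vanishingOn A) := by
  classical
  set L := LinearMap.funLeft (ZMod 2) (ZMod 2) (Subtype.val : {y // y ∈ A} → V) with hL
  have h1 : cutrank G X A =
      Module.finrank (ZMod 2) ((rowSpan G X ⊔ vanishingOn A).map L) := by
    have h2 : (vanishingOn A).map L = ⊥ := by
      rw [eq_bot_iff, Submodule.map_le_iff_le_comap, Submodule.comap_bot]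
      exact le_rfl
    have h3 : Set.range (Matrix.of fun (x : {x // x ∈ X}) (y : {y // y ∈ A}) =>
        if G.Adj x.1 y.1 then (1 : ZMod 2) else 0).row = L '' (adjRow G '' (X : Set V)) := by
      ext f
      constructor
      · rintro ⟨x, rfl⟩
        refine ⟨_, ⟨x.1, x.2, rfl⟩, ?_⟩
        ext y
        simp only [hL, LinearMap.funLeft_apply, adjRow, Matrix.row, Matrix.of_apply]
      · rintro ⟨_, ⟨x, hx, rfl⟩, rfl⟩
        refine ⟨⟨x, hx⟩, ?_⟩
        ext y
        simp only [hL, LinearMap.funLeft_apply, adjRow, Matrix.row, Matrix.of_apply]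
    rw [Submodule.map_sup, h2, sup_bot_eq, rowSpan, Submodule.map_span, ← h3,
      ← Matrix.rank_eq_finrank_span_row, cutrank]
  have h3 := LinearMap.finrank_range_add_finrank_ker (L.domRestrict (rowSpan G X ⊔ vanishingOn A))
  rw [LinearMap.range_domRestrict, ← h1] at h3
  rw [← h3, LinearMap.ker_domRestrict]
  congr 1
  have h4 : (vanishingOn A) ≤ rowSpan G X ⊔ vanishingOn A := le_sup_right
  exact (LinearEquiv.finrank_eq (Submodule.comapSubtypeEquivOfLe h4)).symm

/-- Bisubmodularity of the rank of submatrices. -/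
theorem cutrank_bisubmodular {V : Type*} [Fintype V] [DecidableEq V] (G : SimpleGraph V)
    (X₁ X₂ A₁ A₂ : Finset V) :
    cutrank G (X₁ ∪ X₂) (A₁ ∩ A₂) + cutrank G (X₁ ∩ X₂) (A₁ ∪ A₂) ≤
      cutrank G X₁ A₁ + cutrank G X₂ A₂ := by
  have e1 := cutrank_add_finrank_vanishingOn G (X₁ ∪ X₂) (A₁ ∩ A₂)
  have e2 := cutrank_add_finrank_vanishingOn G (X₁ ∩ X₂) (A₁ ∪ A₂)
  have e3 := cutrank_add_finrank_vanishingOn G X₁ A₁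
  have e4 := cutrank_add_finrank_vanishingOn G X₂ A₂
  have e5 := Submodule.finrank_sup_add_finrank_inf_eq (vanishingOn A₁) (vanishingOn A₂)
  have e6 := Submodule.finrank_sup_add_finrank_inf_eq (rowSpan G X₁ ⊔ vanishingOn A₁)
    (rowSpan G X₂ ⊔ vanishingOn A₂)
  rw [← vanishingOn_inter, ← vanishingOn_union] at e5
  have e7 : rowSpan G X₁ ⊔ vanishingOn A₁ ⊔ (rowSpan G X₂ ⊔ vanishingOn A₂) =
      rowSpan G (X₁ ∪ X₂) ⊔ vanishingOn (A₁ ∩ A₂) := by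
    rw [rowSpan_union, vanishingOn_inter, sup_sup_sup_comm]
  have e8 : rowSpan G (X₁ ∩ X₂) ⊔ vanishingOn (A₁ ∪ A₂) ≤
      (rowSpan G X₁ ⊔ vanishingOn A₁) ⊓ (rowSpan G X₂ ⊔ vanishingOn A₂) := by
    rw [vanishingOn_union]
    exact le_inf (sup_le_sup (rowSpan_mono G Finset.inter_subset_left) inf_le_left)
      (sup_le_sup (rowSpan_mono G Finset.inter_subset_right) inf_le_right)
  have e9 := Submodule.finrank_mono e8
  rw [e7] at e6
  omega

theorem cutrank_comm {V : Type*} (G : SimpleGraph V) (X A : Finset V) :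
    cutrank G X A = cutrank G A X := by
  classical
  rw [cutrank, cutrank, ← Matrix.rank_transpose]
  congr 1
  ext i j
  simp [Matrix.transpose_apply, G.adj_comm]

theorem cutrank_le_card_left {V : Type*} (G : SimpleGraph V) (X A : Finset V) :
    cutrank G X A ≤ X.card := by
  exact (Matrix.rank_le_card_height _).trans_eq (Fintype.card_coe X)

theorem cutrank_empty_left {V : Type*} (G : SimpleGraph V) (A : Finset V) :
    cutrank G ∅ A = 0 := by
  simpa using cutrank_le_card_left G ∅ A

theorem cutrank_empty_right {V : Type*} (G : SimpleGraph V) (A : Finset V) :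
    cutrank G A ∅ = 0 := by
  rw [cutrank_comm, cutrank_empty_left]

theorem cutrank_mono {V : Type*} [Fintype V] (G : SimpleGraph V) {X Y A B : Finset V}
    (hX : X ⊆ Y) (hA : A ⊆ B) : cutrank G X A ≤ cutrank G Y B := by
  classical
  have key (A X Y : Finset V) (hX : X ⊆ Y) : cutrank G X A ≤ cutrank G Y A := by
    have h := cutrank_bisubmodular G Y X A ∅
    simpa [cutrank_empty_right, Finset.union_eq_left.2 hX, Finset.inter_eq_right.2 hX] using h
  refine (key A X Y hX).trans ?_
  rw [cutrank_comm, cutrank_comm G Y]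
  exact key Y A B hA

theorem cutrank_union_right_le {V : Type*} [Fintype V] [DecidableEq V] (G : SimpleGraph V)
    (X A B : Finset V) : cutrank G X (A ∪ B) ≤ cutrank G X A + cutrank G X B := by
  have := cutrank_bisubmodular G X X A B
  simp at this
  omega

theorem cutrank_map {V W : Type*} (G : SimpleGraph V) (H : SimpleGraph W) (φ : W ↪ V)
    (h : ∀ a b, H.Adj a b ↔ G.Adj (φ a) (φ b)) (X A : Finset W) :
    cutrank H X A = cutrank G (X.map φ) (A.map φ) := by
  have e (X : Finset W) : ∃ e : {x // x ∈ X} ≃ {x // x ∈ X.map φ}, ∀ x, (e x).1 = φ x.1 :=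
    ⟨Equiv.ofBijective (fun x => ⟨φ x.1, Finset.mem_map_of_mem φ x.2⟩)
      ⟨fun a b hab => Subtype.ext (φ.injective (congrArg Subtype.val hab)),
        fun ⟨y, hy⟩ => by
          obtain ⟨x, hx, rfl⟩ := Finset.mem_map.1 hy
          exact ⟨⟨x, hx⟩, rfl⟩⟩, fun x => rfl⟩
  obtain ⟨e₁, h₁⟩ := e X
  obtain ⟨e₂, h₂⟩ := e A
  rw [cutrank, cutrank, ← Matrix.rank_submatrix _ e₁ e₂]
  congr 1
  ext i j
  simp only [Matrix.submatrix_apply, Matrix.of_apply]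
  by_cases hij : H.Adj i.1 j.1
  · have hij' : G.Adj (e₁ i).1 (e₂ j).1 := by rwa [h₁, h₂, ← h]
    rw [if_pos hij, if_pos hij']
  · have hij' : ¬ G.Adj (e₁ i).1 (e₂ j).1 := by rwa [h₁, h₂, ← h]
    rw [if_neg hij, if_neg hij']

/-! ### The connectivity function. -/

/-- The cutrank of `X` against its complement. -/
noncomputable def connectivity {V : Type*} [Fintype V] [DecidableEq V] (G : SimpleGraph V)
    (X : Finset V) : ℕ :=
  cutrank G X Xᶜ

section Connectivity

variable {V : Type*} [Fintype V] [DecidableEq V] (G : SimpleGraph V)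

theorem connectivity_compl (X : Finset V) : connectivity G Xᶜ = connectivity G X := by
  rw [connectivity, connectivity, compl_compl, cutrank_comm]

theorem connectivity_submodular (X Y : Finset V) :
    connectivity G (X ∪ Y) + connectivity G (X ∩ Y) ≤ connectivity G X + connectivity G Y := by
  have := cutrank_bisubmodular G X Y Xᶜ Yᶜ
  rwa [← Finset.compl_union, ← Finset.compl_inter] at this

theorem connectivity_union_le (X Y : Finset V) :
    connectivity G (X ∪ Y) ≤ connectivity G X + connectivity G Y :=
  (Nat.le_add_right _ _).trans (connectivity_submodular G X Y)

theorem connectivity_le_card (X : Finset V) : connectivity G X ≤ X.card :=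
  cutrank_le_card_left G X _

theorem connectivity_univ : connectivity G Finset.univ = 0 := by
  rw [connectivity, Finset.compl_univ, cutrank_empty_right]

end Connectivity

/-! ### From non-decomposability to a tangle. -/

/-- A set that can be built from singletons by disjoint unions without ever exceeding `w`. -/
inductive Decomposable {V : Type*} [DecidableEq V] (f : Finset V → ℕ) (w : ℕ) : Finset V → Prop
  | single (v : V) : f {v} ≤ w → Decomposable f w {v}
  | union (X Y : Finset V) : Disjoint X Y → Decomposable f w X → Decomposable f w Y →
      f (X ∪ Y) ≤ w → Decomposable f w (X ∪ Y)

section LowerBound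

variable {V : Type*} [Fintype V] [DecidableEq V] {G : SimpleGraph V}

/-- If the whole vertex set is not `w`-decomposable, some set has connectivity exactly `w` and
cannot be split into two nonempty parts of connectivity at most `w`. -/
theorem exists_unsplittable [Nonempty V] {w : ℕ} (hw : 1 ≤ w)
    (h : ¬ Decomposable (connectivity G) w Finset.univ) :
    ∃ B : Finset V, connectivity G B = w ∧ ∀ X Y : Finset V, X.Nonempty → Y.Nonempty →
      Disjoint X Y → X ∪ Y = B → w < connectivity G X ∨ w < connectivity G Y := by
  have hs (v : V) : connectivity G {v} ≤ 1 := by simpa using connectivity_le_card G {v}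
  -- A smallest non-decomposable set of connectivity at most `w`: in any split within `w` both parts
  -- would be decomposable, hence so would `B`.
  obtain ⟨B, ⟨hne, hB, hBw⟩, hmin⟩ := WellFounded.has_min
    (measure (Finset.card : Finset V → ℕ)).wf
    {B : Finset V | B.Nonempty ∧ ¬ Decomposable (connectivity G) w B ∧ connectivity G B ≤ w}
    ⟨Finset.univ, Finset.univ_nonempty, h, by simp [connectivity_univ]⟩
  have hdec (X : Finset V) (hX : X.Nonempty) (hXw : connectivity G X ≤ w)
      (hc : X.card < B.card) : Decomposable (connectivity G) w X := by
    by_contra hd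
    exact hmin X ⟨hX, hd, hXw⟩ hc
  have hsplit (X Y : Finset V) (hX : X.Nonempty) (hY : Y.Nonempty) (hd : Disjoint X Y)
      (hXY : X ∪ Y = B) : w < connectivity G X ∨ w < connectivity G Y := by
    by_contra! hcon
    have hcard := Finset.card_union_of_disjoint hd
    rw [hXY] at hcard
    have := hX.card_pos
    have := hY.card_pos
    refine hB (hXY ▸ Decomposable.union X Y hd (hdec X hX hcon.1 (by omega))
      (hdec Y hY hcon.2 (by omega)) (hXY ▸ hBw))
  refine ⟨B, le_antisymm hBw ?_, hsplit⟩
  -- With slack below `w`, peeling off one vertex raises connectivity by at most 1, so it would be a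
  -- forbidden split.
  by_contra! hlt
  obtain ⟨v, hv⟩ := hne
  by_cases hB1 : (B.erase v).Nonempty
  · have hu : {v} ∪ B.erase v = B := by
      rw [← Finset.insert_eq, Finset.insert_erase hv]
    have hc : connectivity G (B.erase v) ≤ connectivity G B + 1 := by
      have h1 : (B.erase v)ᶜ = Bᶜ ∪ {v} := by
        clear * -
        grind [Finset.mem_compl]
      have h2 := connectivity_union_le G Bᶜ {v}
      rw [← h1, connectivity_compl, connectivity_compl] at h2
      exact h2.trans (Nat.add_le_add_left (hs v) _)
    rcases hsplit {v} (B.erase v) (by simp) hB1 (by simp) hu with h1 | h1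
    · have := hs v; omega
    · omega
  · rw [Finset.not_nonempty_iff_eq_empty, Finset.erase_eq_empty_iff] at hB1
    rcases hB1 with rfl | rfl
    · simp at hv
    · exact hB (Decomposable.single v hBw)

/-- The properties of the small sides of a tangle of order `σ + 1` that are used below. -/
structure IsTangle (G : SimpleGraph V) (σ : ℕ) (P : Finset V → Prop) : Prop where
  mono : ∀ X Y, X ⊆ Y → P Y → P X
  cover : ∀ X Y Z, P X → P Y → P Z → X ∪ Y ∪ Z ≠ Finset.univ
  small_or : ∀ X, connectivity G X ≤ σ → P X ∨ P Xᶜ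
  single : ∀ v, P {v}

/-- Take `B` unsplittable with λ(B) = 3σ + 1, and call a set small if its trace outside `B` lies in
some `Z ⊆ Bᶜ` with λ(Z) ≤ σ. Three small sets covering everything would give λ(B) ≤ 3σ. If neither
`U` nor `Uᶜ` is small, uncrossing each with `B` shows that `U ∩ B` and `Uᶜ ∩ B` split `B`. -/
theorem exists_isTangle [Nonempty V] {σ : ℕ} (hσ : 1 ≤ σ)
    (h : ¬ Decomposable (connectivity G) (3 * σ + 1) Finset.univ) :
    ∃ P, IsTangle G σ P := by
  obtain ⟨B, hB, hsplit⟩ := exists_unsplittable (by omega) h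
  refine ⟨fun Y => ∃ Z, Y ∩ Bᶜ ⊆ Z ∧ Z ⊆ Bᶜ ∧ connectivity G Z ≤ σ, ?_, ?_, ?_, ?_⟩
  · rintro X Y hXY ⟨Z, h1, h2, h3⟩
    exact ⟨Z, (Finset.inter_subset_inter_right hXY).trans h1, h2, h3⟩
  · rintro X₁ X₂ X₃ ⟨Z₁, h1, h1', h1''⟩ ⟨Z₂, h2, h2', h2''⟩ ⟨Z₃, h3, h3', h3''⟩ hu
    have hA : Z₁ ∪ Z₂ ∪ Z₃ = Bᶜ := by
      apply Finset.Subset.antisymm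
      · exact Finset.union_subset (Finset.union_subset h1' h2') h3'
      · intro v hv
        have : v ∈ X₁ ∪ X₂ ∪ X₃ := hu ▸ Finset.mem_univ v
        clear * - hv this h1 h2 h3
        grind
    have e1 := connectivity_union_le G (Z₁ ∪ Z₂) Z₃
    have e2 := connectivity_union_le G Z₁ Z₂
    rw [hA, connectivity_compl, hB] at e1
    omega
  · intro U hU
    by_contra! hcon
    have key (U : Finset V) (hU : connectivity G U ≤ σ)
        (hP : ∀ Z, U ∩ Bᶜ ⊆ Z → Z ⊆ Bᶜ → σ < connectivity G Z) :
        (U ∩ B).Nonempty ∧ connectivity G (Uᶜ ∩ B) ≤ 3 * σ + 1 := by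
      constructor
      · rw [Finset.nonempty_iff_ne_empty]
        intro he
        have := hP U Finset.inter_subset_left (fun v hv => by
          rw [Finset.mem_compl]
          intro hvB
          have : v ∈ U ∩ B := Finset.mem_inter.2 ⟨hv, hvB⟩
          rw [he] at this
          simp at this)
        omega
      · have e1 := connectivity_submodular G Uᶜ B
        have e2 : (Uᶜ ∪ B)ᶜ = U ∩ Bᶜ := by rw [Finset.compl_union, compl_compl]
        have e3 := hP _ subset_rfl Finset.inter_subset_right
        rw [← e2, connectivity_compl] at e3
        rw [connectivity_compl] at e1
        omega
    obtain ⟨h1, h2⟩ := key U hU hcon.1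
    obtain ⟨h3, h4⟩ := key Uᶜ (by rwa [connectivity_compl]) hcon.2
    rw [compl_compl] at h4
    rcases hsplit (U ∩ B) (Uᶜ ∩ B) h1 h3
      (Finset.disjoint_left.2 (by intro v; simp; tauto)) (by ext v; simp; tauto) with h5 | h5
    · omega
    · omega
  · intro v
    refine ⟨{v} ∩ Bᶜ, subset_rfl, Finset.inter_subset_right, ?_⟩
    refine (connectivity_le_card G _).trans (le_trans ?_ hσ)
    simpa using Finset.card_le_card (Finset.inter_subset_left (s₁ := {v}) (s₂ := Bᶜ))

/-! ### Evenly linked subsets. -/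

/-- Matroid closure: for fixed columns the row rank is submodular, so rows that are individually
redundant are jointly redundant. -/
theorem cutrank_union_left_le_of_forall (X T A : Finset V)
    (h : ∀ v ∈ T, cutrank G (insert v X) A ≤ cutrank G X A) :
    cutrank G (X ∪ T) A ≤ cutrank G X A := by
  induction T using Finset.induction_on with
  | empty => simp
  | insert v T hv ih =>
    have h1 := ih fun u hu => h u (Finset.mem_insert_of_mem hu)
    have h2 := h v (Finset.mem_insert_self v T)
    have h3 := cutrank_bisubmodular G (X ∪ T) (insert v X) A A
    have h4 : X ∪ T ∪ insert v X = X ∪ insert v T := by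
      clear * -
      grind
    have h5 : cutrank G X (A ∪ A) ≤ cutrank G ((X ∪ T) ∩ insert v X) (A ∪ A) :=
      cutrank_mono G (by clear * -; grind) subset_rfl
    rw [h4, Finset.inter_self, Finset.union_self] at h3
    rw [Finset.union_self] at h5
    omega

/-- If the complement of `B` maximizes `|Y| - c * connectivity Y` among its own subsets, then it
contains a set `Y'` of size `c * connectivity B` that has the full rank to `B` and each of whose
subsets is linked to the rest at rate `c`. -/
theorem exists_evenly_linked_subset (B : Finset V) {c : ℕ} (hc : 0 < c)
    (h : ∀ Y ⊆ Bᶜ, Y.card + c * connectivity G B ≤ Bᶜ.card + c * connectivity G Y) :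
    ∃ Y ⊆ Bᶜ, Y.card = c * connectivity G B ∧ connectivity G B ≤ cutrank G B Y ∧
      ∀ Z ⊆ Y, Z.card ≤ c * cutrank G Z (Y \ Z ∪ B) := by
  classical
  obtain ⟨Y, hY, hmax⟩ := Finset.exists_max_image
    (Bᶜ.powerset.filter fun Y => ∀ Z ⊆ Y, Z.card ≤ c * cutrank G Z (Y \ Z ∪ B)) Finset.card
    ⟨∅, by simp⟩
  simp only [Finset.mem_filter, Finset.mem_powerset] at hY hmax
  obtain ⟨hYB, hlink⟩ := hY
  -- `Y` is a largest linked set and `T` a largest tight subset of it. Uncrossing shows that tight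
  -- sets are closed under union, so `T` contains them all.
  obtain ⟨T, hT, hTmax⟩ := Finset.exists_max_image
    (Y.powerset.filter fun Z => c * cutrank G Z (Y \ Z ∪ B) ≤ Z.card) Finset.card
    ⟨∅, by simp [cutrank_empty_left]⟩
  simp only [Finset.mem_filter, Finset.mem_powerset] at hT hTmax
  obtain ⟨hTY, hTt⟩ := hT
  have hTtop (Z : Finset V) (hZ : Z ⊆ Y) (hZt : c * cutrank G Z (Y \ Z ∪ B) ≤ Z.card) :
      Z ⊆ T := by
    have e1 := cutrank_bisubmodular G T Z (Y \ T ∪ B) (Y \ Z ∪ B)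
    have e2 : (Y \ T ∪ B) ∩ (Y \ Z ∪ B) = Y \ (T ∪ Z) ∪ B := by
      clear * -
      grind
    have e3 : (Y \ T ∪ B) ∪ (Y \ Z ∪ B) = Y \ (T ∩ Z) ∪ B := by
      clear * -
      grind
    rw [e2, e3] at e1
    have e4 := hlink (T ∩ Z) (Finset.inter_subset_left.trans hTY)
    have e5 := Finset.card_union_add_card_inter T Z
    have e6 := hTmax (T ∪ Z) ⟨Finset.union_subset hTY hZ, by nlinarith⟩
    have e7 := Finset.eq_of_subset_of_card_le Finset.subset_union_left e6
    rw [e7]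
    exact Finset.subset_union_right
  -- Adding `v` to `Y` breaks linkedness at some `insert v Z₀`. Then `Z₀` is tight, hence inside
  -- `T`, and `v` adds no rank to `Z₀`; bisubmodularity transfers this to `T`.
  have habs (v : V) (hv : v ∈ Bᶜ \ Y) :
      cutrank G (insert v T) (Y \ T ∪ B) ≤ cutrank G T (Y \ T ∪ B) := by
    obtain ⟨hvB, hvY⟩ := Finset.mem_sdiff.1 hv
    have hfail : ¬ ∀ Z ⊆ insert v Y, Z.card ≤ c * cutrank G Z (insert v Y \ Z ∪ B) := by
      intro hall
      have := hmax (insert v Y) ⟨Finset.insert_subset hvB hYB, hall⟩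
      rw [Finset.card_insert_of_notMem hvY] at this
      omega
    push Not at hfail
    obtain ⟨Z, hZ, hZlt⟩ := hfail
    have hvZ : v ∈ Z := by
      by_contra hvZ
      have h1 : Z ⊆ Y := by
        clear * - hZ hvZ
        grind
      have h2 := hlink Z h1
      have h3 : cutrank G Z (Y \ Z ∪ B) ≤ cutrank G Z (insert v Y \ Z ∪ B) :=
        cutrank_mono G subset_rfl (by clear * -; grind)
      have h4 := Nat.mul_le_mul_left c h3
      omega
    obtain ⟨Z₀, hvZ₀, rfl⟩ : ∃ Z₀, v ∉ Z₀ ∧ Z = insert v Z₀ :=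
      ⟨Z.erase v, by simp, (Finset.insert_erase hvZ).symm⟩
    have hZ₀ : Z₀ ⊆ Y := (Finset.insert_subset_insert_iff hvZ₀).1 hZ
    have hD : insert v Y \ insert v Z₀ = Y \ Z₀ := by
      clear * - hvZ₀ hvY
      grind
    rw [hD, Finset.card_insert_of_notMem hvZ₀] at hZlt
    have h1 := hlink Z₀ hZ₀
    have h2 : cutrank G Z₀ (Y \ Z₀ ∪ B) ≤ cutrank G (insert v Z₀) (Y \ Z₀ ∪ B) :=
      cutrank_mono G (Finset.subset_insert _ _) subset_rfl
    have h2' := Nat.mul_le_mul_left c h2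
    have h3 : cutrank G (insert v Z₀) (Y \ Z₀ ∪ B) ≤ cutrank G Z₀ (Y \ Z₀ ∪ B) :=
      Nat.le_of_mul_le_mul_left (by omega) hc
    have h4 := hTtop Z₀ hZ₀ (by omega)
    have h5 := cutrank_bisubmodular G T (insert v Z₀) (Y \ T ∪ B) (Y \ Z₀ ∪ B)
    have e1 : T ∪ insert v Z₀ = insert v T := by
      clear * - h4
      grind
    have e2 : T ∩ insert v Z₀ = Z₀ := by
      clear * - h4 hTY hvY
      grind
    have e3 : (Y \ T ∪ B) ∩ (Y \ Z₀ ∪ B) = Y \ T ∪ B := by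
      clear * - h4
      grind
    have e4 : (Y \ T ∪ B) ∪ (Y \ Z₀ ∪ B) = Y \ Z₀ ∪ B := by
      clear * - h4
      grind
    rw [e1, e2, e3, e4] at h5
    omega
  have h1 := cutrank_union_left_le_of_forall (G := G) T (Bᶜ \ Y) (Y \ T ∪ B) habs
  have h2 : (T ∪ Bᶜ \ Y)ᶜ = Y \ T ∪ B := by
    ext v
    have := @hTY v
    have := @hYB v
    simp only [Finset.mem_compl, Finset.mem_union, Finset.mem_sdiff] at *
    tauto
  -- All vertices outside `Y ∪ B` are absorbed into `T` at no cost in rank, so the extremality of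
  -- `Bᶜ`, tested on this set, gives c·λ(B) ≤ |Y|. Linkedness of `Y` itself gives the reverse bound.
  have h3 := h (T ∪ Bᶜ \ Y) (Finset.union_subset (hTY.trans hYB) Finset.sdiff_subset)
  rw [connectivity.eq_def G (T ∪ Bᶜ \ Y), h2] at h3
  have h4 := (Nat.mul_le_mul_left c h1).trans hTt
  have h5 : (T ∪ Bᶜ \ Y).card = T.card + (Bᶜ \ Y).card :=
    Finset.card_union_of_disjoint
      (Finset.disjoint_left.2 fun v hv hv' => (Finset.mem_sdiff.1 hv').2 (hTY hv))
  have h6 := Finset.card_sdiff_add_card_eq_card hYB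
  have h7 := hlink Y subset_rfl
  rw [Finset.sdiff_self, Finset.empty_union, cutrank_comm] at h7
  have h8 : cutrank G B Y ≤ connectivity G B := cutrank_mono G subset_rfl hYB
  have h9 := Nat.mul_le_mul_left c h8
  exact ⟨Y, hYB, by omega, Nat.le_of_mul_le_mul_left (by omega) hc, hlink⟩

/-! ### A tangle is incompatible with balanced cuts. -/

/-- The complements of the small sets of connectivity at most `σ`. -/
def IsBig (G : SimpleGraph V) (σ : ℕ) (P : Finset V → Prop) (B : Finset V) : Prop :=
  connectivity G B ≤ σ ∧ P Bᶜ

section Tangle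

variable {σ : ℕ} {P : Finset V → Prop} (hP : IsTangle G σ P)
include hP

/-- If both parts were small, they and the small set `Bᶜ` would cover everything. -/
theorem IsTangle.isBig_or {B X Y : Finset V} (hB : IsBig G σ P B) (hXY : X ∪ Y = B)
    (hX : connectivity G X ≤ σ) (hY : connectivity G Y ≤ σ) :
    IsBig G σ P X ∨ IsBig G σ P Y := by
  rcases hP.small_or X hX with h1 | h1
  · rcases hP.small_or Y hY with h2 | h2
    · exact absurd (by rw [hXY]; simp) (hP.cover X Y Bᶜ h1 h2 hB.2)
    · exact Or.inr ⟨hY, h2⟩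
  · exact Or.inl ⟨hX, h1⟩

theorem IsTangle.isBig_univ : IsBig G σ P Finset.univ := by
  have h0 : connectivity G Finset.univ ≤ σ := by simp [connectivity_univ]
  rcases hP.small_or _ h0 with h | h
  · exact absurd (by simp) (hP.cover _ _ _ h h h)
  · exact ⟨h0, h⟩

theorem IsTangle.two_le_card {B : Finset V} (hB : IsBig G σ P B) : 2 ≤ B.card := by
  by_contra! hlt
  have h1 : B.card ≤ 1 := by omega
  rcases B.eq_empty_or_nonempty with rfl | ⟨v, hv⟩
  · exact hP.cover _ _ _ hB.2 hB.2 hB.2 (by simp)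
  · have : B = {v} := Finset.eq_singleton_iff_unique_mem.2
      ⟨hv, fun u hu => Finset.card_le_one.1 h1 u hu v hv⟩
    subst this
    exact hP.cover _ _ _ (hP.single v) hB.2 hB.2 (by ext; simp)

theorem IsTangle.exists_isBig_min (c : ℕ) : ∃ B, IsBig G σ P B ∧ ∀ B', IsBig G σ P B' →
    B.card + c * connectivity G B ≤ B'.card + c * connectivity G B' := by
  classical
  obtain ⟨B, hB, hmin⟩ := Finset.exists_min_image (Finset.univ.filter (IsBig G σ P))
    (fun B => B.card + c * connectivity G B) ⟨Finset.univ, by simpa using hP.isBig_univ⟩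
  exact ⟨B, by simpa using hB, fun B' hB' => hmin B' (by simpa using hB')⟩

end Tangle

/-- Every induced subgraph on at least two vertices has a balanced cut of rank at most `k`. -/
def HasBalancedCuts (G : SimpleGraph V) (k : ℕ) : Prop :=
  ∀ S : Finset V, 2 ≤ S.card → ∃ X Y : Finset V, Disjoint X Y ∧ X ∪ Y = S ∧
    3 * X.card ≤ 2 * S.card ∧ 3 * Y.card ≤ 2 * S.card ∧ cutrank G X Y ≤ k

theorem connectivity_le_of_cut {B X Y : Finset V} (hXY : X ∪ Y = B) :
    connectivity G X ≤ cutrank G X Y + connectivity G B := by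
  have h1 : cutrank G X Xᶜ ≤ cutrank G X (Y ∪ Bᶜ) := cutrank_mono G subset_rfl (by
    intro v hv
    simp only [← hXY, Finset.mem_compl, Finset.mem_union] at hv ⊢
    tauto)
  have h2 : cutrank G X Bᶜ ≤ cutrank G B Bᶜ :=
    cutrank_mono G (hXY ▸ Finset.subset_union_left) subset_rfl
  have h3 := cutrank_union_right_le G X Y Bᶜ
  rw [connectivity, connectivity]
  omega

/-- A big set of low connectivity that minimizes `|B| + c * connectivity B` has no balanced cut
of low rank, unless it is small compared to `c`. -/
theorem IsTangle.card_le_of_low {k c : ℕ} {P : Finset V → Prop} (hP : IsTangle G (16 * k) P)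
    (hbal : HasBalancedCuts G k) {B : Finset V} (hB : IsBig G (16 * k) P B)
    (hmin : ∀ B', IsBig G (16 * k) P B' →
      B.card + c * connectivity G B ≤ B'.card + c * connectivity G B')
    (hlow : connectivity G B ≤ 15 * k) : B.card ≤ 3 * (c * k) := by
  obtain ⟨X, Y, hd, hXY, hX, hY, hk⟩ := hbal B (hP.two_le_card hB)
  have h1 := connectivity_le_of_cut (G := G) hXY
  have h2 := connectivity_le_of_cut (G := G) ((Finset.union_comm Y X).trans hXY)
  rw [cutrank_comm] at h2
  -- Both parts have connectivity at most 15k + k, which is exactly the order the tangle decides.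
  rcases hP.isBig_or hB hXY (by omega) (by omega) with h | h
  · have h3 := hmin X h
    have h4 : c * connectivity G X ≤ c * (k + connectivity G B) :=
      Nat.mul_le_mul_left c (by omega)
    rw [Nat.mul_add] at h4
    omega
  · have h3 := hmin Y h
    have h4 : c * connectivity G Y ≤ c * (k + connectivity G B) :=
      Nat.mul_le_mul_left c (by omega)
    rw [Nat.mul_add] at h4
    omega

/-- Uncross `(X, X')` with `(B, Y)`. Since `Y` already has full rank to `B`, a second uncrossing
with `(B, Bᶜ)` extends the columns seen by `X ∩ B` from `Y ∪ X'` to its whole complement at no cost.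
-/
theorem connectivity_inter_add_le {B Y X X' : Finset V} (hY : Y ⊆ Bᶜ) (hX : X ∪ X' = Y ∪ B)
    (hfull : connectivity G B ≤ cutrank G B Y) :
    connectivity G (X ∩ B) + cutrank G (X' ∩ Y) (Y \ (X' ∩ Y) ∪ B) ≤
      cutrank G X X' + connectivity G B := by
  have h1 := cutrank_bisubmodular G X B X' Y
  have h2 := cutrank_bisubmodular G (X ∩ B) B (Y ∪ X') Bᶜ
  have h3 : cutrank G (X ∩ B) (X ∩ B)ᶜ ≤ cutrank G (X ∩ B ∩ B) (Y ∪ X' ∪ Bᶜ) :=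
    cutrank_mono G (by clear * -; grind) (by
      intro v hv
      have h4 : v ∈ X ∪ X' ↔ v ∈ Y ∪ B := by rw [hX]
      simp only [Finset.mem_union, Finset.mem_inter, Finset.mem_compl] at *
      tauto)
  have h5 : cutrank G B Y ≤ cutrank G (X ∩ B ∪ B) ((Y ∪ X') ∩ Bᶜ) :=
    cutrank_mono G Finset.subset_union_right (by
      intro v hv
      exact Finset.mem_inter.2 ⟨Finset.mem_union_left _ hv, hY hv⟩)
  have h6 : cutrank G (Y \ (X' ∩ Y) ∪ B) (X' ∩ Y) ≤ cutrank G (X ∪ B) (X' ∩ Y) :=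
    cutrank_mono G (by
      intro v hv
      have h4 : v ∈ X ∪ X' ↔ v ∈ Y ∪ B := by rw [hX]
      simp only [Finset.mem_union, Finset.mem_inter, Finset.mem_sdiff] at *
      tauto) subset_rfl
  have h7 : cutrank G B Y ≤ connectivity G B := cutrank_mono G subset_rfl hY
  rw [cutrank_comm] at h6
  rw [Finset.union_comm X' Y] at h1
  rw [connectivity.eq_def G (X ∩ B)]
  have h8 : cutrank G B Bᶜ = connectivity G B := rfl
  omega

/-- A big set `B` of high connectivity that minimizes `|B| + c * connectivity B` is large compared
to `c`. -/
theorem IsTangle.lt_card_of_high {k c : ℕ} (hk : 1 ≤ k) {P : Finset V → Prop}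
    (hP : IsTangle G (16 * k) P) (hbal : HasBalancedCuts G k) {B : Finset V}
    (hB : IsBig G (16 * k) P B)
    (hmin : ∀ B', IsBig G (16 * k) P B' →
      B.card + c * connectivity G B ≤ B'.card + c * connectivity G B')
    (hhigh : 15 * k ≤ connectivity G B) : c * connectivity G B < 4 * B.card := by
  by_contra! hcard
  have hB2 := hP.two_le_card hB
  have hc : 0 < c := by
    rcases Nat.eq_zero_or_pos c with rfl | h
    · omega
    · exact h
  obtain ⟨Y, hY, hYcard, hfull, hlink⟩ := exists_evenly_linked_subset (G := G) B hc (by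
    intro Y hY
    by_cases hYs : connectivity G B ≤ connectivity G Y
    · exact Nat.add_le_add (Finset.card_le_card hY) (Nat.mul_le_mul_left c hYs)
    -- Since `Y` lies in the small set `Bᶜ` and has lower connectivity than `B`, its complement
    -- competes with `B` in the minimization.
    · have hbig : IsBig G (16 * k) P Yᶜ := by
        refine ⟨?_, ?_⟩
        · rw [connectivity_compl]
          have := hB.1
          omega
        · rw [compl_compl]
          exact hP.mono _ _ hY hB.2
      have h1 := hmin _ hbig
      rw [connectivity_compl] at h1
      have h2 := Finset.card_add_card_compl B
      have h3 := Finset.card_add_card_compl Y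
      omega)
  have hS : (Y ∪ B).card = Y.card + B.card :=
    Finset.card_union_of_disjoint
      (Finset.disjoint_left.2 fun v hv => Finset.mem_compl.1 (hY hv))
  obtain ⟨X, X', hd, hXX, hX, hX', hcut⟩ := hbal (Y ∪ B) (by omega)
  have hcards := Finset.card_union_of_disjoint hd
  rw [hXX] at hcards
  have key (X X' : Finset V) (hXX : X ∪ X' = Y ∪ B) (hcard : (Y ∪ B).card ≤ 3 * X'.card)
      (hcut : cutrank G X X' ≤ k) : connectivity G (X ∩ B) < connectivity G B := by
    have h1 := connectivity_inter_add_le hY hXX hfull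
    have h2 := hlink (X' ∩ Y) Finset.inter_subset_right
    set t := cutrank G (X' ∩ Y) (Y \ (X' ∩ Y) ∪ B)
    have h3 : X'.card ≤ (X' ∩ Y).card + B.card :=
      (Finset.card_le_card (t := X' ∩ Y ∪ B) (by
        intro v hv
        have : v ∈ Y ∪ B := hXX ▸ Finset.mem_union_right X hv
        clear * - hv this
        grind)).trans (Finset.card_union_le _ _)
    -- `X'` has at least a third of |Y| + |B|, and 4|B| ≤ |Y| = c·λ(B), so it contains at least
    -- c·λ(B)/6 vertices of `Y`. Hence t ≥ 15k/6 > k.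
    have h4 : c * connectivity G B ≤ c * (6 * t) := by
      rw [Nat.mul_left_comm]
      omega
    have h5 := Nat.le_of_mul_le_mul_left h4 hc
    omega
  have h1 := key X X' hXX (by omega) hcut
  have h2 := key X' X ((Finset.union_comm X' X).trans hXX) (by omega) (by rwa [cutrank_comm])
  have hBσ := hB.1
  have hbig := hP.isBig_or hB (X := X ∩ B) (Y := X' ∩ B)
    (by rw [← Finset.union_inter_distrib_right, hXX, Finset.union_inter_cancel_right]) (by omega) (by omega)
  have fin (Z : Finset V) (hZ : IsBig G (16 * k) P (Z ∩ B))
      (hlt : connectivity G (Z ∩ B) < connectivity G B) : False := by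
    have h3 := hmin _ hZ
    have h4 := Finset.card_le_card (Finset.inter_subset_right (s₁ := Z) (s₂ := B))
    have h5 := Nat.mul_lt_mul_of_pos_left hlt hc
    omega
  rcases hbig with h | h
  · exact fin X h h1
  · exact fin X' h h2

/-- Induction on `c` keeps some minimizer at connectivity at least 15k, which is absurd once `c`
exceeds the number of vertices. -/
theorem IsTangle.not_hasBalancedCuts {k : ℕ} (hk : 1 ≤ k) {P : Finset V → Prop}
    (hP : IsTangle G (16 * k) P) : ¬ HasBalancedCuts G k := by
  intro hbal
  let High (c : ℕ) : Prop := ∃ B, IsBig G (16 * k) P B ∧ (∀ B', IsBig G (16 * k) P B' →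
      B.card + c * connectivity G B ≤ B'.card + c * connectivity G B') ∧
      15 * k ≤ connectivity G B
  have hlow (c : ℕ) (hc : ¬ High c) : ∃ B, IsBig G (16 * k) P B ∧
      B.card ≤ 3 * (c * k) ∧ connectivity G B < 15 * k := by
    obtain ⟨B, hB, hmin⟩ := hP.exists_isBig_min c
    have h1 : connectivity G B < 15 * k := by
      by_contra! h
      exact hc ⟨B, hB, hmin, h⟩
    exact ⟨B, hB, hP.card_le_of_low hbal hB hmin h1.le, h1⟩
  have hall (c : ℕ) : High c := by
    induction c with
    | zero =>
      by_contra h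
      obtain ⟨B, hB, h1, -⟩ := hlow 0 h
      have := hP.two_le_card hB
      omega
    | succ c ih =>
      by_contra h
      obtain ⟨B₁, hB₁, h1, h2⟩ := hlow (c + 1) h
      obtain ⟨B₂, hB₂, hmin, h3⟩ := ih
      have h4 := hP.lt_card_of_high hk hbal hB₂ hmin h3
      have h5 := hmin B₁ hB₁
      have h6 := connectivity_le_card G B₂
      have h7 : c * connectivity G B₁ ≤ c * connectivity G B₂ :=
        Nat.mul_le_mul_left c (by omega)
      have h8 : c * (15 * k) ≤ c * connectivity G B₂ := Nat.mul_le_mul_left c h3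
      rw [Nat.mul_left_comm] at h8
      rw [Nat.add_mul] at h1
      -- Minimality at `c` gives |B₂| ≤ |B₁| ≤ 3(c + 1)k. From |B₂| ≥ 15k follows c ≥ 4, whereas
      -- 15ck < 4|B₂| ≤ 12(c + 1)k forces c < 4.
      omega
  obtain ⟨B, hB, hmin, h1⟩ := hall (Fintype.card V + 1)
  have h2 := hmin _ hP.isBig_univ
  rw [connectivity_univ, Nat.mul_zero, Finset.card_univ] at h2
  have h3 : (Fintype.card V + 1) * 1 ≤ (Fintype.card V + 1) * connectivity G B :=
    Nat.mul_le_mul_left _ (by omega)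
  omega

/-- If all induced subgraphs have balanced cuts of rank at most `k`, then the vertex set is
decomposable. -/
theorem HasBalancedCuts.decomposable [Nonempty V] {k : ℕ} (hk : 1 ≤ k)
    (h : HasBalancedCuts G k) :
    Decomposable (connectivity G) (3 * (16 * k) + 1) Finset.univ := by
  by_contra hd
  obtain ⟨P, hP⟩ := exists_isTangle (by omega) hd
  exact hP.not_hasBalancedCuts hk h

end LowerBound

/-! ### Deleting an edge of a tree. -/

section Trees

variable {T : Type*} {H : SimpleGraph T}

theorem reachable_deleteEdges_step {a x y : T} {e : Sym2 T}
    (h : (H.deleteEdges {e}).Reachable a x) (hxy : H.Adj x y) (he : s(x, y) ≠ e) :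
    (H.deleteEdges {e}).Reachable a y :=
  h.trans (SimpleGraph.Adj.reachable (SimpleGraph.deleteEdges_adj.2 ⟨hxy, by simpa using he⟩))

/-- Induction along the edges of a connected graph. -/
theorem SimpleGraph.Preconnected.induction_adj (hH : H.Preconnected) {a : T} {p : T → Prop}
    (ha : p a) (hstep : ∀ x y, H.Adj x y → p x → p y) (x : T) : p x := by
  have h := (SimpleGraph.reachable_iff_reflTransGen a x).1 (hH a x)
  induction h with
  | refl => exact ha
  | tail _ hadj ih => exact hstep _ _ hadj ih

theorem reachable_deleteEdges_or (hH : H.Preconnected) (a b x : T) :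
    (H.deleteEdges {s(a, b)}).Reachable a x ∨ (H.deleteEdges {s(a, b)}).Reachable b x := by
  refine hH.induction_adj (a := a) (p := fun x => (H.deleteEdges {s(a, b)}).Reachable a x ∨
    (H.deleteEdges {s(a, b)}).Reachable b x) (Or.inl (SimpleGraph.Reachable.refl a)) ?_ x
  intro x y hxy hx
  by_cases he : s(x, y) = s(a, b)
  · rcases Sym2.eq_iff.1 he with ⟨-, rfl⟩ | ⟨-, rfl⟩
    · exact Or.inr (SimpleGraph.Reachable.refl _)
    · exact Or.inl (SimpleGraph.Reachable.refl _)
  · exact hx.imp (reachable_deleteEdges_step · hxy he) (reachable_deleteEdges_step · hxy he)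

theorem not_reachable_deleteEdges (hH : H.IsAcyclic) {a b x : T} (hab : H.Adj a b)
    (hx : (H.deleteEdges {s(a, b)}).Reachable a x) :
    ¬ (H.deleteEdges {s(a, b)}).Reachable b x := by
  intro hx'
  have := (SimpleGraph.isAcyclic_iff_forall_adj_isBridge.1 hH) hab
  rw [SimpleGraph.isBridge_iff] at this
  exact this (hx.trans hx'.symm)

theorem exists_adj_reachable_deleteEdges (hH : H.Preconnected) (b x : T) :
    x = b ∨ ∃ c, H.Adj b c ∧ (H.deleteEdges {s(c, b)}).Reachable c x := by
  refine hH.induction_adj (a := b) (p := fun x => x = b ∨ ∃ c, H.Adj b c ∧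
    (H.deleteEdges {s(c, b)}).Reachable c x) (Or.inl rfl) ?_ x
  rintro x y hxy (rfl | ⟨c, hbc, hx⟩)
  · exact Or.inr ⟨y, hxy, SimpleGraph.Reachable.refl _⟩
  · by_cases he : s(x, y) = s(c, b)
    · rcases Sym2.eq_iff.1 he with ⟨-, rfl⟩ | ⟨-, rfl⟩
      · exact Or.inl rfl
      · exact Or.inr ⟨y, hbc, SimpleGraph.Reachable.refl _⟩
    · exact Or.inr ⟨c, hbc, reachable_deleteEdges_step hx hxy he⟩

/-- Beyond an edge `bc` of a tree lie only nodes that are on the side of `b` of any other edge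
`ab`. -/
theorem reachable_deleteEdges_of_ne (hH : H.IsTree) {a b c x : T} (hab : H.Adj a b)
    (hbc : H.Adj b c) (hac : a ≠ c) (hx : (H.deleteEdges {s(c, b)}).Reachable c x) :
    (H.deleteEdges {s(b, a)}).Reachable b x := by
  have hpre := hH.connected.preconnected
  rcases reachable_deleteEdges_or hpre b a x with h | h
  · exact h
  · exfalso
    have key (y : T) (hy : Relation.ReflTransGen (H.deleteEdges {s(b, a)}).Adj a y) :
        (H.deleteEdges {s(c, b)}).Reachable b y := by
      induction hy with
      | refl =>
        refine reachable_deleteEdges_step (SimpleGraph.Reachable.refl b) hab.symm ?_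
        intro he
        rcases Sym2.eq_iff.1 he with ⟨-, rfl⟩ | ⟨-, rfl⟩
        · exact hab.ne rfl
        · exact hac rfl
      | @tail y z hy hyz ih =>
        have hyr : (H.deleteEdges {s(b, a)}).Reachable a y :=
          (SimpleGraph.reachable_iff_reflTransGen a y).2 hy
        refine reachable_deleteEdges_step ih (SimpleGraph.deleteEdges_adj.1 hyz).1 ?_
        intro he
        have hb : ¬ (H.deleteEdges {s(b, a)}).Reachable a b := by
          have := not_reachable_deleteEdges hH.isAcyclic hab.symm
            (SimpleGraph.Reachable.refl b)
          exact this
        rcases Sym2.eq_iff.1 he with ⟨-, rfl⟩ | ⟨rfl, -⟩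
        · exact hb (hyr.trans hyz.reachable)
        · exact hb hyr
    have h1 := key x ((SimpleGraph.reachable_iff_reflTransGen a x).1 h)
    exact not_reachable_deleteEdges hH.isAcyclic hbc.symm hx h1

end Trees

/-! ### Balanced edges in a rank-decomposition. -/

theorem minBalCutrank_induce_eq_zero {V : Type*} (G : SimpleGraph V) {S : Finset V}
    (hS : S.card ≤ 1) : minBalCutrank (G.induce (S : Set V)) = 0 := by
  rw [minBalCutrank]
  rcases Set.eq_empty_or_nonempty {c | ∃ X Y : Finset (S : Set V), IsBalancedPartition X Y ∧
    c = cutrank (G.induce (S : Set V)) X Y} with h | ⟨c, hc⟩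
  · rw [h, Nat.sInf_empty]
  · refine Nat.le_zero.1 ((Nat.sInf_le hc).trans ?_)
    obtain ⟨X, Y, ⟨-, -, hX, -⟩, rfl⟩ := hc
    have hcard : Fintype.card (S : Set V) = S.card := by simp
    rw [hcard] at hX
    have := cutrank_le_card_left (G.induce (S : Set V)) X Y
    omega

namespace RankDecomposition

variable {V : Type*} [Fintype V]

theorem mem_side {D : RankDecomposition V} {a b : Fin D.size} {v : V} :
    v ∈ D.side a b ↔ (D.tree.deleteEdges {s(a, b)}).Reachable a (D.leaf v).1 := by
  simp [side]

theorem side_union_side [DecidableEq V] (D : RankDecomposition V) (a b : Fin D.size) :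
    D.side a b ∪ D.side b a = Finset.univ := by
  ext v
  simp only [Finset.mem_union, mem_side, Sym2.eq_swap (a := b), Finset.mem_univ, iff_true]
  exact reachable_deleteEdges_or D.isTree.connected.preconnected a b _

theorem disjoint_side (D : RankDecomposition V) {a b : Fin D.size} (hab : D.tree.Adj a b) :
    Disjoint (D.side a b) (D.side b a) := by
  refine Finset.disjoint_left.2 fun v hv => ?_
  rw [mem_side] at hv ⊢
  rw [Sym2.eq_swap]
  exact not_reachable_deleteEdges D.isTree.isAcyclic hab hv

theorem card_side_inter_add [DecidableEq V] (D : RankDecomposition V) {a b : Fin D.size}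
    (hab : D.tree.Adj a b) (S : Finset V) :
    (D.side a b ∩ S).card + (D.side b a ∩ S).card = S.card := by
  rw [← Finset.card_union_of_disjoint ((D.disjoint_side hab).mono Finset.inter_subset_left
    Finset.inter_subset_left), ← Finset.union_inter_distrib_right, side_union_side,
    Finset.univ_inter]

/-- Every set of at least two vertices is split in a balanced way by some edge of the tree. -/
theorem exists_balanced_edge [DecidableEq V] (D : RankDecomposition V) (S : Finset V)
    (hS : 2 ≤ S.card) : ∃ a b, D.tree.Adj a b ∧ 3 * (D.side a b ∩ S).card ≤ 2 * S.card ∧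
      3 * (D.side b a ∩ S).card ≤ 2 * S.card := by
  classical
  by_contra! hcon
  have hpre := D.isTree.connected.preconnected
  have hheavy (a b : Fin D.size) (hab : D.tree.Adj a b) :
      2 * S.card < 3 * (D.side a b ∩ S).card ∨ 2 * S.card < 3 * (D.side b a ∩ S).card := by
    by_contra! h
    have := hcon a b hab h.1
    omega
  obtain ⟨a₀, b₀, hab₀⟩ : ∃ a b, D.tree.Adj a b := by
    obtain ⟨u, hu, v, hv, huv⟩ := Finset.one_lt_card.1 hS
    rcases exists_adj_reachable_deleteEdges hpre (D.leaf u).1 (D.leaf v).1 with h | ⟨c, hc, -⟩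
    · exact absurd (D.leaf.injective (Subtype.ext h)).symm huv
    · exact ⟨_, c, hc⟩
  -- Without a balanced edge every edge has a heavy side. Take one with the fewest tree nodes; then
  -- every branch at `b` carries less than a third of `S`.
  obtain ⟨⟨b, a⟩, hba, hmin⟩ := Finset.exists_min_image
    (Finset.univ.filter fun p : Fin D.size × Fin D.size =>
      D.tree.Adj p.1 p.2 ∧ 2 * S.card < 3 * (D.side p.1 p.2 ∩ S).card)
    (fun p => {x | (D.tree.deleteEdges {s(p.1, p.2)}).Reachable p.1 x}.ncard) (by
      rcases hheavy a₀ b₀ hab₀ with h | h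
      · exact ⟨(a₀, b₀), by simp [hab₀, h]⟩
      · exact ⟨(b₀, a₀), by simp [hab₀.symm, h]⟩)
  simp only [Finset.mem_filter, Finset.mem_univ, true_and] at hba hmin
  have hlight (c : Fin D.size) (hbc : D.tree.Adj b c) :
      3 * (D.side c b ∩ S).card ≤ S.card - 1 := by
    have hsum := D.card_side_inter_add hbc S
    rcases hheavy b c hbc with h | h
    · omega
    · exfalso
      by_cases hac : a = c
      · subst hac
        omega
      · have h1 := hmin (c, b) ⟨hbc.symm, h⟩
        refine absurd h1 (not_le.2 (Set.ncard_lt_ncard ?_ (Set.toFinite _)))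
        refine (Set.ssubset_iff_of_subset ?_).2 ⟨b, SimpleGraph.Reachable.refl b, ?_⟩
        · intro x hx
          exact reachable_deleteEdges_of_ne D.isTree hba.1.symm hbc hac hx
        · intro hb
          exact not_reachable_deleteEdges D.isTree.isAcyclic hbc.symm hb
            (SimpleGraph.Reachable.refl b)
  have hcover : S ⊆ (S.filter fun v => (D.leaf v).1 = b) ∪
      (D.tree.neighborFinset b).biUnion fun c => D.side c b ∩ S := by
    intro v hv
    rw [Finset.mem_union, Finset.mem_filter, Finset.mem_biUnion]
    rcases exists_adj_reachable_deleteEdges hpre b (D.leaf v).1 with h | ⟨c, hc, h⟩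
    · exact Or.inl ⟨hv, h⟩
    · exact Or.inr ⟨c, by simpa using hc, Finset.mem_inter.2 ⟨mem_side.2 h, hv⟩⟩
  have h1 := (Finset.card_le_card hcover).trans (Finset.card_union_le _ _)
  have h2 : 3 * ((D.tree.neighborFinset b).biUnion fun c => D.side c b ∩ S).card ≤
      D.tree.degree b * (S.card - 1) := by
    refine (Nat.mul_le_mul_left 3 Finset.card_biUnion_le).trans ?_
    rw [Finset.mul_sum, ← SimpleGraph.card_neighborFinset_eq_degree]
    refine (Finset.sum_le_card_nsmul _ _ _ fun c hc => hlight c (by simpa using hc)).trans ?_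
    rw [smul_eq_mul]
  have h3 : (S.filter fun v => (D.leaf v).1 = b).card ≤ 1 := by
    refine Finset.card_le_one.2 fun u hu v hv => D.leaf.injective (Subtype.ext ?_)
    rw [(Finset.mem_filter.1 hu).2, (Finset.mem_filter.1 hv).2]
  have h4 : D.tree.degree b ≤ 3 := by convert D.degree_le b
  -- A node of degree at most one may carry one element of `S` itself, but has at most one branch; a
  -- node of larger degree carries none and has at most three branches. Neither accounts for all of
  -- `S`.
  by_cases h5 : D.tree.degree b ≤ 1
  · have h6 := h2.trans (Nat.mul_le_mul_right (S.card - 1) h5)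
    omega
  · have h6 : (S.filter fun v => (D.leaf v).1 = b).card = 0 := by
      rw [Finset.card_eq_zero, Finset.filter_eq_empty_iff]
      rintro v - rfl
      exact h5 (by convert (D.leaf v).2)
    have h7 := h2.trans (Nat.mul_le_mul_right (S.card - 1) h4)
    omega

theorem cutrank_side_le_width (G : SimpleGraph V) (D : RankDecomposition V) {a b : Fin D.size}
    (hab : D.tree.Adj a b) : cutrank G (D.side a b) (D.side b a) ≤ D.width G := by
  have h (d : D.tree.Dart) (s : Finset D.tree.Dart) (hd : d ∈ s) :
      cutrank G (D.side d.fst d.snd) (D.side d.snd d.fst) ≤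
        s.sup fun d => cutrank G (D.side d.fst d.snd) (D.side d.snd d.fst) :=
    Finset.le_sup (f := fun d : D.tree.Dart =>
      cutrank G (D.side d.fst d.snd) (D.side d.snd d.fst)) hd
  unfold width
  exact h ⟨(a, b), hab⟩ _ (@Finset.mem_univ _ (_) _)

theorem minBalCutrank_induce_le_width (G : SimpleGraph V) (D : RankDecomposition V)
    (S : Finset V) : minBalCutrank (G.induce (S : Set V)) ≤ D.width G := by
  classical
  have hcard : Fintype.card (S : Set V) = S.card := by simp
  by_cases hS : 2 ≤ S.card
  · obtain ⟨a, b, hab, h1, h2⟩ := D.exists_balanced_edge S hS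
    let A (a b : Fin D.size) : Finset (S : Set V) := Finset.univ.filter fun v => v.1 ∈ D.side a b
    have hA (a b : Fin D.size) : (A a b).map (Function.Embedding.subtype _) = D.side a b ∩ S := by
      ext v
      simp [A]
    have hAc (a b : Fin D.size) : (A a b).card = (D.side a b ∩ S).card := by
      rw [← hA, Finset.card_map]
    have hmem : cutrank (G.induce (S : Set V)) (A a b) (A b a) ∈
        {c | ∃ X Y : Finset (S : Set V), IsBalancedPartition X Y ∧
          c = cutrank (G.induce (S : Set V)) X Y} := by
      refine ⟨A a b, A b a, ⟨?_, ?_, ?_, ?_⟩, rfl⟩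
      · refine Finset.disjoint_left.2 fun v hv hv' => ?_
        simp only [A, Finset.mem_filter] at hv hv'
        exact Finset.disjoint_left.1 (D.disjoint_side hab) hv.2 hv'.2
      · intro v
        have := Finset.mem_univ v.1
        rw [← D.side_union_side a b, Finset.mem_union] at this
        simpa [A] using this
      · rwa [hAc, hcard]
      · rwa [hAc, hcard]
    refine (Nat.sInf_le hmem).trans ?_
    rw [cutrank_map G (G.induce (S : Set V)) (Function.Embedding.subtype _) (by simp), hA, hA]
    refine (cutrank_mono G Finset.inter_subset_left Finset.inter_subset_left).trans ?_
    exact D.cutrank_side_le_width G hab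
  · rw [minBalCutrank_induce_eq_zero G (by omega)]
    exact Nat.zero_le _

end RankDecomposition

/-! ### From assemblies to trees. -/

/-- A rooted tree `H` whose nodes of degree at most one are labelled by the elements of `X`. Each
edge is the only edge leaving some set of nodes avoiding the root, and the set of labels in it has
`f`-value at most `w`. -/
structure IsLayout {V T : Type*} (f : Finset V → ℕ) (w : ℕ) (X : Finset V) (H : SimpleGraph T)
    (root : T) (label : V → T) : Prop where
  reachable : ∀ t, H.Reachable root t
  cut : ∀ a b, H.Adj a b → ∃ N : Set T, root ∉ N ∧ ¬ (a ∈ N ↔ b ∈ N) ∧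
    (∀ x y, H.Adj x y → x ∈ N → y ∉ N → s(x, y) = s(a, b)) ∧
    ∃ Z ⊆ X, (∀ v ∈ X, v ∈ Z ↔ label v ∈ N) ∧ f Z ≤ w
  degree_le : ∀ t, (H.neighborSet t).ncard ≤ 3
  degree_root : (H.neighborSet root).ncard = 0 ∨ (H.neighborSet root).ncard = 2
  label_bijOn : Set.BijOn label X {t | (H.neighborSet t).ncard ≤ 1}

theorem isLayout_single {V : Type*} (f : Finset V → ℕ) (w : ℕ) (v : V) :
    IsLayout f w {v} (⊥ : SimpleGraph Unit) () (fun _ => ()) where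
  reachable _ := SimpleGraph.Reachable.refl _
  cut a b h := h.elim
  degree_le t := by simp [SimpleGraph.neighborSet]
  degree_root := by simp [SimpleGraph.neighborSet]
  label_bijOn := by
    refine ⟨fun _ _ => by simp [SimpleGraph.neighborSet], ?_, ?_⟩
    · intro a ha b hb _
      simp at ha hb
      rw [ha, hb]
    · rintro ⟨⟩ -
      exact ⟨v, by simp, rfl⟩

section Attach

/-! Attaching a rooted tree `H` by its root to a new node `n`. -/

variable {V T T' : Type*} {f : Finset V → ℕ} {w : ℕ} {X : Finset V}
  {H : SimpleGraph T} {r : T} {label : V → T}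
  {H' : SimpleGraph T'} {φ : T → T'} {n : T'} (hφ : Function.Injective φ) (hn : ∀ t, φ t ≠ n)
  (hadj : ∀ x y', H'.Adj (φ x) y' ↔ (∃ y, y' = φ y ∧ H.Adj x y) ∨ (x = r ∧ y' = n))

include hadj in
theorem IsLayout.reachable_attach (hH : IsLayout f w X H r label) (t : T) :
    H'.Reachable n (φ t) := by
  have h1 : H'.Reachable n (φ r) := (((hadj r n).2 (Or.inr ⟨rfl, rfl⟩)).symm).reachable
  refine h1.trans ?_
  let g : H →g H' := ⟨φ, fun {a b} h => (hadj a (φ b)).2 (Or.inl ⟨b, rfl, h⟩)⟩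
  exact (hH.reachable t).map g

include hφ hn hadj in
-- The new edge raises the root degree from 0 to 1 or from 2 to 3, so no node changes its status as
-- a leaf. This is why layouts exclude roots of degree 1.
theorem IsLayout.ncard_attach [Finite T] (hH : IsLayout f w X H r label) (t : T) :
    (H'.neighborSet (φ t)).ncard ≤ 3 ∧
      ((H'.neighborSet (φ t)).ncard ≤ 1 ↔ (H.neighborSet t).ncard ≤ 1) := by
  by_cases ht : t = r
  · subst ht
    have h1 : H'.neighborSet (φ t) = insert n (φ '' H.neighborSet t) := by
      ext y
      simp only [SimpleGraph.mem_neighborSet, hadj, Set.mem_insert_iff, Set.mem_image]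
      constructor
      · rintro (⟨y, rfl, h⟩ | ⟨-, rfl⟩)
        · exact Or.inr ⟨y, h, rfl⟩
        · exact Or.inl rfl
      · rintro (rfl | ⟨y, h, rfl⟩)
        · exact Or.inr ⟨trivial, rfl⟩
        · exact Or.inl ⟨y, rfl, h⟩
    rw [h1, Set.ncard_insert_of_notMem (by rintro ⟨x, -, hx⟩; exact hn x hx)
      (Set.toFinite _), Set.ncard_image_of_injective _ hφ]
    rcases hH.degree_root with h | h <;> rw [h] <;> simp
  · have h1 : H'.neighborSet (φ t) = φ '' H.neighborSet t := by
      ext y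
      simp only [SimpleGraph.mem_neighborSet, hadj, Set.mem_image]
      constructor
      · rintro (⟨y, rfl, h⟩ | ⟨h, -⟩)
        · exact ⟨y, h, rfl⟩
        · exact absurd h ht
      · rintro ⟨y, h, rfl⟩
        exact Or.inl ⟨y, rfl, h⟩
    rw [h1, Set.ncard_image_of_injective _ hφ]
    exact ⟨hH.degree_le t, Iff.rfl⟩

include hφ hn hadj in
-- An old edge keeps its certificate, which avoids the old root and so is not crossed by the new
-- edge. The new edge is certified by the whole attached tree, with label set `X`.
theorem IsLayout.cut_attach (hH : IsLayout f w X H r label) (hX : f X ≤ w) {X' : Finset V}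
    (hXX : X ⊆ X') {label' : V → T'} (hl : ∀ v ∈ X, label' v = φ (label v))
    (hl' : ∀ v ∈ X', v ∉ X → label' v ∉ Set.range φ) (a : T) (b' : T')
    (hab : H'.Adj (φ a) b') : ∃ N : Set T', n ∉ N ∧ ¬ (φ a ∈ N ↔ b' ∈ N) ∧
    (∀ x y, H'.Adj x y → x ∈ N → y ∉ N → s(x, y) = s(φ a, b')) ∧
    ∃ Z ⊆ X', (∀ v ∈ X', v ∈ Z ↔ label' v ∈ N) ∧ f Z ≤ w := by
  rcases (hadj a b').1 hab with ⟨b, rfl, hab'⟩ | ⟨rfl, rfl⟩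
  · obtain ⟨N, hr, hN, hcross, Z, hZX, hZ, hfZ⟩ := hH.cut a b hab'
    refine ⟨φ '' N, ?_, ?_, ?_, Z, hZX.trans hXX, ?_, hfZ⟩
    · rintro ⟨x, -, hx⟩
      exact hn x hx
    · rwa [hφ.mem_set_image, hφ.mem_set_image]
    · rintro _ y' hxy ⟨x, hx, rfl⟩ hy'
      rcases (hadj x y').1 hxy with ⟨y, rfl, hxy'⟩ | ⟨rfl, rfl⟩
      · rw [hφ.mem_set_image] at hy'
        have := hcross x y hxy' hx hy'
        simpa using congrArg (Sym2.map φ) this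
      · exact absurd hx hr
    · intro v hv
      by_cases hvX : v ∈ X
      · rw [hl v hvX, hφ.mem_set_image]
        exact hZ v hvX
      · refine iff_of_false (fun h => hvX (hZX h)) fun h => hl' v hv hvX ?_
        exact Set.image_subset_range _ _ h
  · refine ⟨Set.range φ, ?_, ?_, ?_, X, hXX, ?_, hX⟩
    · rintro ⟨x, hx⟩
      exact hn x hx
    · intro h
      obtain ⟨x, hx⟩ := h.1 ⟨a, rfl⟩
      exact hn x hx
    · rintro _ y' hxy ⟨x, rfl⟩ hy'
      rcases (hadj x y').1 hxy with ⟨y, rfl, -⟩ | ⟨rfl, rfl⟩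
      · exact absurd ⟨y, rfl⟩ hy'
      · rfl
    · intro v hv
      by_cases hvX : v ∈ X
      · simp [hvX, hl v hvX]
      · exact iff_of_false hvX (hl' v hv hvX)

end Attach

/-- Two rooted trees joined by a new root. -/
def joinTrees {T₁ T₂ : Type*} (H₁ : SimpleGraph T₁) (H₂ : SimpleGraph T₂) (r₁ : T₁) (r₂ : T₂) :
    SimpleGraph (Option (T₁ ⊕ T₂)) where
  Adj
    | some (.inl x), some (.inl y) => H₁.Adj x y
    | some (.inr x), some (.inr y) => H₂.Adj x y
    | none, some (.inl x) => x = r₁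
    | some (.inl x), none => x = r₁
    | none, some (.inr x) => x = r₂
    | some (.inr x), none => x = r₂
    | _, _ => False
  symm := ⟨by
    rintro (_ | x | x) (_ | y | y) h
    all_goals first | exact h | exact SimpleGraph.Adj.symm h⟩
  loopless := ⟨by
    rintro (_ | x | x) h
    all_goals first | exact h | exact SimpleGraph.Adj.ne h rfl⟩

theorem IsLayout.join {V T₁ T₂ : Type*} [DecidableEq V] [Finite T₁] [Finite T₂]
    {f : Finset V → ℕ} {w : ℕ} {X Y : Finset V} {H₁ : SimpleGraph T₁} {H₂ : SimpleGraph T₂}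
    {r₁ : T₁} {r₂ : T₂} {l₁ : V → T₁} {l₂ : V → T₂} (h₁ : IsLayout f w X H₁ r₁ l₁)
    (h₂ : IsLayout f w Y H₂ r₂ l₂) (hd : Disjoint X Y) (hX : f X ≤ w) (hY : f Y ≤ w) :
    IsLayout f w (X ∪ Y) (joinTrees H₁ H₂ r₁ r₂) none
      (fun v => if v ∈ X then some (.inl (l₁ v)) else some (.inr (l₂ v))) := by
  have hadj₁ (x : T₁) (y' : Option (T₁ ⊕ T₂)) : (joinTrees H₁ H₂ r₁ r₂).Adj (some (.inl x)) y' ↔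
      (∃ y, y' = some (.inl y) ∧ H₁.Adj x y) ∨ (x = r₁ ∧ y' = none) := by
    rcases y' with _ | y | y <;> simp [joinTrees]
  have hadj₂ (x : T₂) (y' : Option (T₁ ⊕ T₂)) : (joinTrees H₁ H₂ r₁ r₂).Adj (some (.inr x)) y' ↔
      (∃ y, y' = some (.inr y) ∧ H₂.Adj x y) ∨ (x = r₂ ∧ y' = none) := by
    rcases y' with _ | y | y <;> simp [joinTrees]
  have hinj₁ : Function.Injective (fun x : T₁ => (some (.inl x) : Option (T₁ ⊕ T₂))) :=
    (Option.some_injective _).comp Sum.inl_injective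
  have hinj₂ : Function.Injective (fun x : T₂ => (some (.inr x) : Option (T₁ ⊕ T₂))) :=
    (Option.some_injective _).comp Sum.inr_injective
  have hdeg₁ := h₁.ncard_attach hinj₁ (fun _ => by simp) hadj₁
  have hdeg₂ := h₂.ncard_attach hinj₂ (fun _ => by simp) hadj₂
  have hroot : ((joinTrees H₁ H₂ r₁ r₂).neighborSet none).ncard = 2 := by
    rw [← Set.ncard_pair (a := (some (.inl r₁) : Option (T₁ ⊕ T₂))) (b := some (.inr r₂))
      (by simp)]
    congr 1
    ext y
    rcases y with _ | y | y <;> simp [joinTrees]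
  have hYX (v : V) (hv : v ∈ Y) : v ∉ X := fun h => Finset.disjoint_left.1 hd h hv
  have hcut₁ := h₁.cut_attach hinj₁ (fun _ => by simp) hadj₁ hX (X' := X ∪ Y)
    Finset.subset_union_left
    (label' := fun v => if v ∈ X then some (.inl (l₁ v)) else some (.inr (l₂ v)))
    (fun v hv => by simp [hv]) (fun v _ hv => by simp [hv])
  have hcut₂ := h₂.cut_attach hinj₂ (fun _ => by simp) hadj₂ hY (X' := X ∪ Y)
    Finset.subset_union_right
    (label' := fun v => if v ∈ X then some (.inl (l₁ v)) else some (.inr (l₂ v)))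
    (fun v hv => by simp [hYX v hv]) (fun v hv hv' => by
      have : v ∈ X := (Finset.mem_union.1 hv).resolve_right hv'
      simp [this])
  refine ⟨?_, ?_, ?_, Or.inr hroot, ?_, ?_, ?_⟩
  · rintro (_ | t | t)
    · exact SimpleGraph.Reachable.refl _
    · exact h₁.reachable_attach hadj₁ t
    · exact h₂.reachable_attach hadj₂ t
  · rintro (_ | a | a) (_ | b | b) hab
    · exact hab.elim
    · obtain ⟨N, hN, h3, h4, h5⟩ := hcut₁ b none hab.symm
      exact ⟨N, hN, fun h => h3 h.symm,
        fun x y hxy hx hy => (h4 x y hxy hx hy).trans Sym2.eq_swap, h5⟩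
    · obtain ⟨N, hN, h3, h4, h5⟩ := hcut₂ b none hab.symm
      exact ⟨N, hN, fun h => h3 h.symm,
        fun x y hxy hx hy => (h4 x y hxy hx hy).trans Sym2.eq_swap, h5⟩
    · exact hcut₁ a _ hab
    · exact hcut₁ a _ hab
    · exact hcut₁ a _ hab
    · exact hcut₂ a _ hab
    · exact hcut₂ a _ hab
    · exact hcut₂ a _ hab
  · rintro (_ | t | t)
    · omega
    · exact (hdeg₁ t).1
    · exact (hdeg₂ t).1
  · intro v hv
    by_cases hvX : v ∈ X
    · simp only [hvX, if_true]
      exact (hdeg₁ _).2.2 (h₁.label_bijOn.mapsTo hvX)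
    · simp only [hvX, if_false]
      exact (hdeg₂ _).2.2 (h₂.label_bijOn.mapsTo ((Finset.mem_union.1 hv).resolve_left hvX))
  · intro u hu v hv huv
    by_cases huX : u ∈ X <;> by_cases hvX : v ∈ X <;> simp [huX, hvX] at huv
    · exact h₁.label_bijOn.injOn huX hvX huv
    · exact h₂.label_bijOn.injOn ((Finset.mem_union.1 hu).resolve_left huX)
        ((Finset.mem_union.1 hv).resolve_left hvX) huv
  · rintro (_ | t | t) ht
    · rw [Set.mem_ofPred_eq, hroot] at ht
      omega
    · obtain ⟨v, hv, rfl⟩ := h₁.label_bijOn.surjOn ((hdeg₁ t).2.1 ht)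
      exact ⟨v, Finset.mem_union_left _ hv, if_pos hv⟩
    · obtain ⟨v, hv, rfl⟩ := h₂.label_bijOn.surjOn ((hdeg₂ t).2.1 ht)
      exact ⟨v, Finset.mem_union_right _ hv, if_neg (hYX v hv)⟩

theorem IsLayout.transport {V T T' : Type*} {f : Finset V → ℕ} {w : ℕ} {X : Finset V}
    {H : SimpleGraph T} {r : T} {l : V → T} (h : IsLayout f w X H r l) (e : T' ≃ T) :
    IsLayout f w X (H.comap e) (e.symm r) (fun v => e.symm (l v)) := by
  have hdeg (t : T') : ((H.comap e).neighborSet t).ncard = (H.neighborSet (e t)).ncard := by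
    rw [← Set.ncard_image_of_injective _ e.injective]
    congr 1
    ext y
    simp only [Set.mem_image, SimpleGraph.mem_neighborSet, SimpleGraph.comap_adj]
    exact ⟨fun ⟨x, hx, hxy⟩ => hxy ▸ hx, fun hy => ⟨e.symm y, by simpa using hy, by simp⟩⟩
  refine ⟨fun t => ?_, fun a b hab => ?_, fun t => ?_, ?_, ?_, ?_, ?_⟩
  · let g : H →g H.comap e := ⟨e.symm, fun {a b} hab => by simpa using hab⟩
    simpa [g] using (h.reachable (e t)).map g
  · obtain ⟨N, hr, hN, hcross, Z, hZX, hZ, hfZ⟩ := h.cut (e a) (e b) hab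
    refine ⟨e ⁻¹' N, by simpa using hr, hN, fun x y hxy hx hy => ?_, Z, hZX, by simpa using hZ,
      hfZ⟩
    have := hcross (e x) (e y) hxy hx hy
    simpa using congrArg (Sym2.map e.symm) this
  · rw [hdeg]
    exact h.degree_le _
  · simpa [hdeg] using h.degree_root
  · intro v hv
    simpa [hdeg] using h.label_bijOn.mapsTo hv
  · intro u hu v hv huv
    exact h.label_bijOn.injOn hu hv (e.symm.injective huv)
  · intro t ht
    rw [Set.mem_ofPred_eq, hdeg] at ht
    obtain ⟨v, hv, hvt⟩ := h.label_bijOn.surjOn ht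
    exact ⟨v, hv, by simp [hvt]⟩

theorem Decomposable.le {V : Type*} [DecidableEq V] {f : Finset V → ℕ} {w : ℕ} {X : Finset V}
    (h : Decomposable f w X) : f X ≤ w := by
  cases h <;> assumption

theorem Decomposable.exists_isLayout {V : Type*} [DecidableEq V] {f : Finset V → ℕ} {w : ℕ}
    {X : Finset V} (h : Decomposable f w X) :
    ∃ (T : Type) (_ : Finite T) (H : SimpleGraph T) (r : T) (l : V → T),
      IsLayout f w X H r l := by
  induction h with
  | single v => exact ⟨Unit, inferInstance, ⊥, (), fun _ => (), isLayout_single f w v⟩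
  | union X Y hd hX hY _ ihX ihY =>
    obtain ⟨T₁, _, H₁, r₁, l₁, h₁⟩ := ihX
    obtain ⟨T₂, _, H₂, r₂, l₂, h₂⟩ := ihY
    exact ⟨_, inferInstance, _, _, _, h₁.join h₂ hd hX.le hY.le⟩

theorem not_reachable_of_cut {T : Type*} {H : SimpleGraph T} {a b x y : T} {N : Set T}
    (hcross : ∀ x y, H.Adj x y → x ∈ N → y ∉ N → s(x, y) = s(a, b)) (hx : x ∈ N) (hy : y ∉ N) :
    ¬ (H.deleteEdges {s(a, b)}).Reachable x y := by
  intro h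
  have h' := (SimpleGraph.reachable_iff_reflTransGen x y).1 h
  clear h
  induction h' with
  | refl => exact hy hx
  | @tail u v _ huv ih =>
    by_cases hu : u ∈ N
    · have h1 := SimpleGraph.deleteEdges_adj.1 huv
      exact h1.2 (hcross u v h1.1 hu hy)
    · exact ih hu

/-- A decomposable vertex set has a rank-decomposition of the same width. -/
theorem Decomposable.exists_rankDecomposition {V : Type*} [Fintype V] [DecidableEq V]
    {G : SimpleGraph V} {w : ℕ} (h : Decomposable (connectivity G) w Finset.univ) :
    ∃ D : RankDecomposition V, D.width G ≤ w := by
  classical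
  obtain ⟨T, _, H₀, r₀, l₀, h₀⟩ := h.exists_isLayout
  obtain ⟨n, ⟨e⟩⟩ := Finite.exists_equiv_fin T
  obtain ⟨H, r, l, hl⟩ : ∃ (H : SimpleGraph (Fin n)) (r : Fin n) (l : V → Fin n),
      IsLayout (connectivity G) w Finset.univ H r l := ⟨_, _, _, h₀.transport e.symm⟩
  have hdeg (t : Fin n) [Fintype (H.neighborSet t)] :
      H.degree t = (H.neighborSet t).ncard := by
    rw [← SimpleGraph.card_neighborSet_eq_degree, ← Nat.card_eq_fintype_card,
      Nat.card_coe_set_eq]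
  -- The certificate of an edge shows that it is a bridge, so the graph is acyclic.
  have htree : H.IsTree := by
    refine ⟨(SimpleGraph.connected_iff_exists_forall_reachable H).2 ⟨r, hl.reachable⟩, ?_⟩
    rw [SimpleGraph.isAcyclic_iff_forall_adj_isBridge]
    intro a b hab
    rw [SimpleGraph.isBridge_iff]
    obtain ⟨N, -, hN, hcross, -⟩ := hl.cut a b hab
    by_cases ha : a ∈ N
    · exact not_reachable_of_cut hcross ha (by tauto)
    · exact fun hab' => not_reachable_of_cut hcross (by tauto) ha hab'.symm
  let D : RankDecomposition V :=
    { size := n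
      tree := H
      isTree := htree
      degree_le := fun t => (hdeg t).trans_le (hl.degree_le t)
      leaf := Equiv.ofBijective (fun v => ⟨l v, (hdeg (l v)).trans_le
          (hl.label_bijOn.mapsTo (Finset.mem_coe.2 (Finset.mem_univ v)))⟩)
        ⟨fun u v huv => hl.label_bijOn.injOn (by simp) (by simp) (congrArg Subtype.val huv),
          fun ⟨t, ht⟩ => by
            obtain ⟨v, -, hv⟩ := hl.label_bijOn.surjOn ((hdeg t).symm.trans_le ht)
            exact ⟨v, Subtype.ext hv⟩⟩ }
  have key (a b : Fin n) (hab : H.Adj a b) (N : Set (Fin n)) (ha : a ∈ N) (hb : b ∉ N)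
      (hcross : ∀ x y, H.Adj x y → x ∈ N → y ∉ N → s(x, y) = s(a, b)) (v : V) :
      v ∈ D.side a b ↔ l v ∈ N := by
    rw [RankDecomposition.mem_side]
    constructor
    · intro h1
      by_contra h2
      exact not_reachable_of_cut hcross ha h2 h1
    · intro h1
      rcases reachable_deleteEdges_or htree.connected.preconnected a b (l v) with h2 | h2
      · exact h2
      · exact absurd h2.symm (not_reachable_of_cut hcross h1 hb)
  have hside (a b : Fin n) (hab : H.Adj a b) : D.side b a = (D.side a b)ᶜ := by
    have h1 := D.side_union_side a b
    have h2 := D.disjoint_side (a := a) (b := b) hab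
    exact (IsCompl.compl_eq ⟨h2, codisjoint_iff.2 h1⟩).symm
  refine ⟨D, Finset.sup_le ?_⟩
  rintro ⟨⟨a, b⟩, hab⟩ -
  change cutrank G (D.side a b) (D.side b a) ≤ w
  obtain ⟨N, -, hN, hcross, Z, -, hZ, hfZ⟩ := hl.cut a b hab
  by_cases ha : a ∈ N
  · have : D.side a b = Z := by
      ext v
      rw [key a b hab N ha (by tauto) hcross v, hZ v (Finset.mem_univ v)]
    rw [hside a b hab, this]
    exact hfZ
  · have : D.side b a = Z := by
      ext v
      rw [key b a hab.symm N (by tauto) ha (by rwa [Sym2.eq_swap (a := b)]) v,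
        hZ v (Finset.mem_univ v)]
    rw [cutrank_comm, hside b a hab.symm, this]
    exact hfZ

/-! ### Assembling the two inequalities. -/

theorem exists_isBalancedPartition {V : Type*} [Fintype V] (h : 2 ≤ Fintype.card V) :
    ∃ X Y : Finset V, IsBalancedPartition X Y := by
  classical
  obtain ⟨X, -, hX⟩ := Finset.exists_subset_card_eq (s := (Finset.univ : Finset V))
    (n := Fintype.card V / 2) (by rw [Finset.card_univ]; omega)
  have hc := Finset.card_add_card_compl X
  refine ⟨X, Xᶜ, disjoint_compl_right, fun v => ?_, by omega, by omega⟩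
  rw [Finset.mem_compl]
  exact em _

theorem hasBalancedCuts_maxInducedMinBalCutrank {V : Type*} [Fintype V] [DecidableEq V]
    (G : SimpleGraph V) : HasBalancedCuts G (maxInducedMinBalCutrank G) := by
  intro S hS
  have hcard : Fintype.card (S : Set V) = S.card := by simp
  obtain ⟨X₀, Y₀, h₀⟩ := exists_isBalancedPartition (V := (S : Set V)) (hS.trans_eq hcard.symm)
  obtain ⟨X, Y, ⟨hd, hXY, hX, hY⟩, hc⟩ := Nat.sInf_mem
    (s := {c | ∃ X Y : Finset (S : Set V), IsBalancedPartition X Y ∧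
      c = cutrank (G.induce (S : Set V)) X Y}) ⟨_, X₀, Y₀, h₀, rfl⟩
  refine ⟨X.map (Function.Embedding.subtype _), Y.map (Function.Embedding.subtype _),
    (Finset.disjoint_map _).2 hd, ?_, ?_, ?_, ?_⟩
  · ext v
    simp only [Finset.mem_union, Finset.mem_map, Function.Embedding.coe_subtype]
    constructor
    · rintro (⟨x, -, rfl⟩ | ⟨x, -, rfl⟩) <;> exact x.2
    · intro hv
      exact (hXY ⟨v, hv⟩).imp (fun h => ⟨_, h, rfl⟩) (fun h => ⟨_, h, rfl⟩)
  · rwa [Finset.card_map, ← hcard]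
  · rwa [Finset.card_map, ← hcard]
  · rw [← cutrank_map G (G.induce (S : Set V)) (Function.Embedding.subtype _) (by simp), ← hc]
    exact Finset.le_sup (f := fun S : Finset V => minBalCutrank (G.induce (S : Set V)))
      (Finset.mem_univ S)

theorem matrix_rank_eq_zero_iff {m n K : Type*} [Finite m] [Fintype n] [Field K]
    {M : Matrix m n K} : M.rank = 0 ↔ M = 0 := by
  classical
  rw [Matrix.rank, Submodule.finrank_eq_zero, LinearMap.range_eq_bot, ← Matrix.toLin'_apply',
    LinearEquiv.map_eq_zero_iff]

theorem cutrank_pair_ne_zero {V : Type*} {G : SimpleGraph V} {u v : V} (h : G.Adj u v)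
    {X Y : Finset V} (hu : u ∈ X) (hv : v ∈ Y) : cutrank G X Y ≠ 0 := by
  classical
  intro h0
  rw [cutrank, matrix_rank_eq_zero_iff] at h0
  have := congrFun (congrFun h0 ⟨u, hu⟩) ⟨v, hv⟩
  simp [h] at this

theorem rankwidth_le_width {V : Type*} [Fintype V] (G : SimpleGraph V) (D : RankDecomposition V) :
    rankwidth G ≤ D.width G :=
  ciInf_le' _ D

theorem rankwidth_eq_zero {V : Type*} [Fintype V] {G : SimpleGraph V}
    (h : ∀ X Y, cutrank G X Y = 0) : rankwidth G = 0 := by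
  rcases isEmpty_or_nonempty (RankDecomposition V) with _ | ⟨⟨D⟩⟩
  · exact Nat.iInf_of_empty _
  · refine Nat.le_zero.1 ((rankwidth_le_width G D).trans ?_)
    exact Finset.sup_le fun d _ => (h _ _).le

/-- The endpoints of an edge induce a subgraph whose only balanced partitions separate them, with
nonzero rank. So there are no edges. -/
theorem HasBalancedCuts.cutrank_eq_zero {V : Type*} [Fintype V] [DecidableEq V]
    {G : SimpleGraph V} (h : HasBalancedCuts G 0) (X Y : Finset V) : cutrank G X Y = 0 := by
  have hG (u v : V) : ¬ G.Adj u v := by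
    intro huv
    obtain ⟨X, Y, -, hXY, hX, hY, h0⟩ := h {u, v} (Finset.card_pair huv.ne).ge
    rw [Finset.card_pair huv.ne] at hX hY
    have hu : u ∈ X ∪ Y := hXY ▸ Finset.mem_insert_self u {v}
    have hv : v ∈ X ∪ Y := hXY ▸ Finset.mem_insert_of_mem (Finset.mem_singleton_self v)
    have hX' := Finset.card_le_one.1 (show X.card ≤ 1 by omega) u
    have hY' := Finset.card_le_one.1 (show Y.card ≤ 1 by omega) u
    rcases Finset.mem_union.1 hu with hu | hu <;> rcases Finset.mem_union.1 hv with hv | hv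
    · exact huv.ne (hX' hu v hv)
    · exact cutrank_pair_ne_zero huv hu hv (Nat.le_zero.1 h0)
    · exact cutrank_pair_ne_zero huv.symm hv hu (Nat.le_zero.1 h0)
    · exact huv.ne (hY' hu v hv)
  rw [cutrank, matrix_rank_eq_zero_iff]
  ext i j
  simp [hG]

theorem rankwidth_le {V : Type*} [Fintype V] (G : SimpleGraph V) :
    rankwidth G ≤ 72 * maxInducedMinBalCutrank G := by
  classical
  have h := hasBalancedCuts_maxInducedMinBalCutrank G
  rcases isEmpty_or_nonempty V with _ | _
  · rw [rankwidth_eq_zero fun X Y => by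
      rw [Finset.eq_empty_of_isEmpty X, cutrank_empty_left]]
    exact Nat.zero_le _
  -- The case 0 is separate, since the width 48k + 1 is at most 72k only for k ≥ 1.
  · rcases Nat.eq_zero_or_pos (maxInducedMinBalCutrank G) with h0 | hpos
    · rw [h0] at h
      rw [rankwidth_eq_zero h.cutrank_eq_zero]
      exact Nat.zero_le _
    · obtain ⟨D, hD⟩ := (h.decomposable hpos).exists_rankDecomposition
      have := rankwidth_le_width G D
      omega

/-- A lower bound on all widths bounds the infimum in `ℕ` only if the family is nonempty. Adding
vertices one at a time, with the trivial width bound |V|, provides a member. -/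
theorem nonempty_rankDecomposition (V : Type*) [Fintype V] [Nonempty V] :
    Nonempty (RankDecomposition V) := by
  classical
  have h (X : Finset V) (hX : X.Nonempty) :
      Decomposable (connectivity (⊥ : SimpleGraph V)) (Fintype.card V) X := by
    have hle (X : Finset V) : connectivity (⊥ : SimpleGraph V) X ≤ Fintype.card V :=
      (connectivity_le_card _ X).trans (Finset.card_le_univ X)
    induction hX using Finset.Nonempty.cons_induction with
    | singleton v => exact Decomposable.single v (hle _)
    | cons v s hv hs ih =>
      rw [Finset.cons_eq_insert, Finset.insert_eq]
      exact Decomposable.union _ _ (Finset.disjoint_singleton_left.2 hv)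
        (Decomposable.single v (hle _)) ih (hle _)
  obtain ⟨D, -⟩ := (h Finset.univ Finset.univ_nonempty).exists_rankDecomposition
  exact ⟨D⟩

theorem maxInducedMinBalCutrank_le_rankwidth {V : Type*} [Fintype V] (G : SimpleGraph V) :
    maxInducedMinBalCutrank G ≤ rankwidth G := by
  refine Finset.sup_le fun S _ => ?_
  rcases isEmpty_or_nonempty V with _ | _
  · rw [minBalCutrank_induce_eq_zero G (by rw [Finset.eq_empty_of_isEmpty S]; simp)]
    exact Nat.zero_le _
  · have := nonempty_rankDecomposition V
    exact le_ciInf fun D => D.minBalCutrank_induce_le_width G S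

theorem theorem1 {V : Type*} [Fintype V] (G : SimpleGraph V) :
    (∀ r : ℝ, 1 ≤ r → 72 * r ≤ (rankwidth G : ℝ) →
      ∃ S : Finset V, r ≤ (minBalCutrank (G.induce (S : Set V)) : ℝ)) ∧
    (rankwidth G : ℝ) / 72 ≤ (maxInducedMinBalCutrank G : ℝ) ∧
    maxInducedMinBalCutrank G ≤ rankwidth G := by
  have h : (rankwidth G : ℝ) ≤ 72 * (maxInducedMinBalCutrank G : ℝ) := by
    exact_mod_cast rankwidth_le G
  refine ⟨fun r _ hr => ?_, by linarith, maxInducedMinBalCutrank_le_rankwidth G⟩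
  obtain ⟨S, -, hS⟩ := Finset.exists_mem_eq_sup (Finset.univ : Finset (Finset V))
    Finset.univ_nonempty fun S => minBalCutrank (G.induce (S : Set V))
  refine ⟨S, ?_⟩
  rw [← hS]
  change r ≤ (maxInducedMinBalCutrank G : ℝ)
  linarith
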